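/- **Definitions.** An *implication algebra* is a set with a binary operation $\to$ satisfying $(x\to y)\to x=x$, $(x\to y)\to y=(y\to x)\to x$ and $x\to(y\to z)=y\to(x\to z)$. An *implication embedding* is an injective homomorphism of implication algebras. A *cubic algebra* is a join semilattice $\mathcal L$ with greatest element $\mathbf 1$ and a binary operation $\Delta$ such that, writing $x\to y=\Delta(\mathbf 1,\Delta(x\vee y,y))\vee y$, for all $x,y,z$: * $x\le y$ implies $\Delta(y,x)\vee x=y$; * $x\le y\le z$ implies $\Delta(z,\Delta(y,x))=\Delta(\Delta(z,y),\Delta(z,x))$; * $x\le y$ implies $\Delta(y,\Delta(y,x))=x$; * $x\le y\le z$ implies $\Delta(z,x)\le\Delta(z,y)$; * $(x\to y)\to y=x\vee y$ and $x\to(y\to z)=y\to(x\to z)$. Under $\to$ every cubic algebra, and every interval $[a,\mathbf 1]$ in it, is an implication algebra. An *MR-algebra* is a cubic algebra such that whenever $a,b<x$, one has $\Delta(x,a)\vee b<x$ if and only if the meet of $a$ and $b$ does not exist. For $a,b\in\mathcal L$ put $a\simeq b$ iff $\Delta(a\vee b,a)=b$; this is an equivalence relation. Write $[x]$ for the class of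 $x$, and put $a\Rightarrow b=\Delta(a\vee b,a)\to b$. **Theorem.** Let $\mathcal L$ be an MR-algebra. Then $[a]\to[b]=[a\Rightarrow b]$ is a well-defined operation on the quotient $\mathcal L/{\simeq}$ (the collapse of $\mathcal L$) which makes it an implication algebra, and for every $a\in\mathcal L$ the mapping $x\mapsto[x]$ from the interval $[a,\mathbf 1]$, with the implication $\to$ of $\mathcal L$, to $\mathcal L/{\simeq}$ is an implication embedding; that is, it is injective and $[x\to y]=[x]\to[y]$ for all $x,y\in[a,\mathbf 1]$. -/

import Mathlib

/-- An implication algebra: a set with one binary operation `imp`, satisfying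
contraction, quasi-commutativity and exchange. -/
class ImplicationAlgebra (A : Type*) where
  imp : A → A → A
  imp_contraction : ∀ x y : A, imp (imp x y) x = x
  imp_quasi_comm : ∀ x y : A, imp (imp x y) y = imp (imp y x) x
  imp_exchange : ∀ x y z : A, imp x (imp y z) = imp y (imp x z)

/-- An implication embedding: an injective homomorphism of implication algebras. -/
def IsImplicationEmbedding {A B : Type*} [ImplicationAlgebra A] [ImplicationAlgebra B]
    (φ : A → B) : Prop :=
  Function.Injective φ ∧
    ∀ x y : A, φ (ImplicationAlgebra.imp x y) = ImplicationAlgebra.imp (φ x) (φ y)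

/-- The signature of cubic algebras: a join semilattice with a greatest element `⊤`
(written `1` below) and a binary operation `delta`. -/
class DeltaSemilattice (L : Type*) extends SemilatticeSup L, OrderTop L where
  delta : L → L → L

/-- The implication `xy = Δ(1, Δ(x ∨ y, y)) ∨ y`, also written `x → y`. -/
def DeltaSemilattice.arrow {L : Type*} [DeltaSemilattice L] (x y : L) : L :=
  delta ⊤ (delta (x ⊔ y) y) ⊔ y

open DeltaSemilattice in
/-- A cubic algebra. -/
class CubicAlgebra (L : Type*) extends DeltaSemilattice L where
  delta_sup : ∀ x y : L, x ≤ y → delta y x ⊔ x = y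
  delta_delta : ∀ x y z : L, x ≤ y → y ≤ z →
    delta z (delta y x) = delta (delta z y) (delta z x)
  delta_invol : ∀ x y : L, x ≤ y → delta y (delta y x) = x
  delta_mono : ∀ x y z : L, x ≤ y → y ≤ z → delta z x ≤ delta z y
  arrow_arrow : ∀ x y : L, arrow (arrow x y) y = x ⊔ y
  arrow_exchange : ∀ x y z : L, arrow x (arrow y z) = arrow y (arrow x z)

open DeltaSemilattice in
/-- An MR-algebra: a cubic algebra satisfying the MR-axiom. -/
class MRAlgebra (L : Type*) extends CubicAlgebra L where
  mr_axiom : ∀ a b x : L, a < x → b < x →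
    (delta x a ⊔ b < x ↔ ¬ ∃ m : L, IsGLB {a, b} m)

namespace CubicAlgebra

open DeltaSemilattice

/-- `a ≃ b` iff `Δ(a ∨ b, a) = b`. -/
def Similar {L : Type*} [CubicAlgebra L] (a b : L) : Prop := delta (a ⊔ b) a = b

/-- The operation `a ⇒ b = Δ(a ∨ b, a) → b`. -/
def collapseArrow {L : Type*} [CubicAlgebra L] (a b : L) : L := arrow (delta (a ⊔ b) a) b

section Facts

variable {L : Type*} [CubicAlgebra L]

theorem le_arrow (x y : L) : y ≤ arrow x y := le_sup_right

theorem delta_le {x y : L} (h : x ≤ y) : delta y x ≤ y :=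
  le_sup_left.trans (delta_sup x y h).le

theorem delta_self (x : L) : delta x x = x :=
  le_antisymm (delta_le le_rfl)
    ((delta_invol x x le_rfl).symm.le.trans (delta_mono _ _ _ (delta_le le_rfl) le_rfl))

theorem arrow_eq_top_iff (x y : L) : arrow x y = ⊤ ↔ x ≤ y := by
  constructor
  · intro h
    have h1 := arrow_arrow x y
    rw [h] at h1
    unfold arrow at h1
    rw [sup_of_le_left (le_top : y ≤ ⊤), delta_invol y ⊤ le_top, sup_idem] at h1
    rw [h1]
    exact le_sup_left
  · intro h
    unfold arrow
    rw [sup_of_le_right h, delta_self, delta_sup y ⊤ le_top]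

theorem arrow_sup (x y : L) : arrow x y ⊔ x = ⊤ := by
  have h1 := delta_sup (delta (x ⊔ y) y) ⊤ le_top
  have h2 : delta (x ⊔ y) y ≤ x ⊔ y := delta_le le_sup_right
  refine top_unique (h1.symm.le.trans (sup_le (le_sup_left.trans le_sup_left) (h2.trans ?_)))
  exact sup_le le_sup_right ((le_arrow x y).trans le_sup_left)

/-- Every cubic algebra is an implication algebra under `arrow`. -/
instance toImplicationAlgebra : ImplicationAlgebra L where
  imp := arrow
  imp_contraction x y :=
    le_antisymm
      ((arrow_eq_top_iff _ _).1 (by rw [arrow_arrow, arrow_sup]))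
      (le_arrow _ _)
  imp_quasi_comm x y := by rw [arrow_arrow, arrow_arrow, sup_comm]
  imp_exchange := arrow_exchange

/-- The interval `[a, 1]` is closed under `arrow`, hence is an implication algebra. -/
instance iccImplicationAlgebra (a : L) : ImplicationAlgebra (Set.Icc a (⊤ : L)) where
  imp x y := ⟨arrow x.1 y.1, y.2.1.trans (le_arrow _ _), le_top⟩
  imp_contraction x y := Subtype.ext (ImplicationAlgebra.imp_contraction x.1 y.1)
  imp_quasi_comm x y := Subtype.ext (ImplicationAlgebra.imp_quasi_comm x.1 y.1)
  imp_exchange x y z := Subtype.ext (ImplicationAlgebra.imp_exchange x.1 y.1 z.1)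

theorem le_arrow_comm {x y z : L} : x ≤ arrow y z ↔ y ≤ arrow x z := by
  rw [← arrow_eq_top_iff, ← arrow_eq_top_iff, arrow_exchange]

theorem arrow_anti {x y : L} (h : x ≤ y) (z : L) : arrow y z ≤ arrow x z :=
  le_arrow_comm.1 (h.trans (by rw [arrow_arrow]; exact le_sup_left))

theorem arrow_mono {y z : L} (h : y ≤ z) (x : L) : arrow x y ≤ arrow x z := by
  have h1 : arrow (arrow z y) y = z := by rw [arrow_arrow, sup_of_le_left h]
  rw [← h1, arrow_exchange]
  exact le_arrow _ _

theorem arrow_arrow_self (x y : L) : arrow x (arrow x y) = arrow x y := by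
  have h1 : arrow (arrow x y) x = x := ImplicationAlgebra.imp_contraction x y
  have h2 : arrow (arrow (arrow x y) x) (arrow x y) = arrow x y :=
    ImplicationAlgebra.imp_contraction (arrow x y) x
  rwa [h1] at h2

theorem le_of_le_arrow {u s v : L} (h1 : u ≤ s) (h2 : u ≤ arrow s v) : u ≤ v := by
  have h3 : u ≤ arrow u v := h2.trans (arrow_anti h1 v)
  rw [← arrow_eq_top_iff, arrow_arrow_self, arrow_eq_top_iff] at h3
  exact h3

theorem delta_top_top (x : L) : delta ⊤ (delta ⊤ x) = x := delta_invol x ⊤ le_top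

theorem delta_top_mono {x y : L} (h : x ≤ y) : delta ⊤ x ≤ delta ⊤ y :=
  delta_mono x y ⊤ h le_top

theorem delta_top_le {x y : L} : delta ⊤ x ≤ y ↔ x ≤ delta ⊤ y :=
  ⟨fun h => by simpa only [delta_top_top] using delta_top_mono h,
    fun h => by simpa only [delta_top_top] using delta_top_mono h⟩

theorem delta_top_sup (x y : L) : delta ⊤ (x ⊔ y) = delta ⊤ x ⊔ delta ⊤ y := by
  apply le_antisymm
  · rw [delta_top_le]
    exact sup_le (delta_top_le.1 le_sup_left) (delta_top_le.1 le_sup_right)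
  · exact sup_le (delta_top_mono le_sup_left) (delta_top_mono le_sup_right)

theorem delta_top_arrow (x y : L) :
    delta ⊤ (arrow x y) = arrow (delta ⊤ x) (delta ⊤ y) := by
  unfold arrow
  rw [delta_top_sup, delta_delta y (x ⊔ y) ⊤ le_sup_right le_top, delta_top_sup]

/-- `a ⪯ b`, that is `Δ(a ∨ b, a) ≤ b`, in terms of the implication. -/
theorem delta_le_iff (a b : L) : delta (a ⊔ b) a ≤ b ↔ delta ⊤ a ≤ arrow a b := by
  have ha : a ≤ a ⊔ b := le_sup_left
  have hb : b ≤ a ⊔ b := le_sup_right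
  constructor
  · intro h
    have h1 := delta_mono _ _ _ h hb
    rw [delta_invol a _ ha] at h1
    exact (delta_top_mono h1).trans le_sup_left
  · intro h
    have h1 : a ≤ arrow (a ⊔ b) (delta (a ⊔ b) b) := by
      have h2 := delta_top_mono h
      unfold arrow at h2 ⊢
      rw [delta_top_top, delta_top_sup, delta_top_top] at h2
      rw [sup_of_le_left (delta_le hb), delta_invol b _ hb, sup_comm]
      exact h2
    have h3 := delta_mono _ _ _ (le_of_le_arrow ha h1) (delta_le hb)
    rwa [delta_invol b _ hb] at h3

theorem prec_trans {a b c : L} (h1 : delta (a ⊔ b) a ≤ b) (h2 : delta (b ⊔ c) b ≤ c) :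
    delta (a ⊔ c) a ≤ c := by
  rw [delta_le_iff] at h1 h2 ⊢
  have h3 : a ≤ arrow (delta ⊤ a) (delta ⊤ b) := by
    rw [← delta_top_arrow, ← delta_top_le]
    exact h1
  have h4 : delta ⊤ a ≤ arrow (delta ⊤ b) (arrow a c) := by
    rw [arrow_exchange]
    exact h1.trans (arrow_mono (le_arrow_comm.1 h2) a)
  have h5 := h3.trans (arrow_mono (le_arrow_comm.1 h4) (delta ⊤ a))
  rwa [arrow_arrow_self, le_arrow_comm, arrow_arrow_self] at h5

theorem similar_iff (a b : L) :
    Similar a b ↔ delta (a ⊔ b) a ≤ b ∧ delta (b ⊔ a) b ≤ a := by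
  unfold Similar
  rw [sup_comm b a]
  constructor
  · intro h
    refine ⟨h.le, ?_⟩
    have h1 := delta_invol a (a ⊔ b) le_sup_left
    rw [h] at h1
    exact h1.le
  · rintro ⟨h1, h2⟩
    refine le_antisymm h1 ?_
    have h3 := delta_mono _ a (a ⊔ b) h2 le_sup_left
    rwa [delta_invol b _ le_sup_right] at h3

end Facts

/-- The relation `≃` is an equivalence relation. -/
def similarSetoid (L : Type*) [CubicAlgebra L] : Setoid L where
  r := Similar
  iseqv :=
    { refl := fun a => by unfold Similar; rw [sup_idem, delta_self]
      symm := fun {a b} h => (similar_iff b a).2 ((similar_iff a b).1 h).symm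
      trans := fun {a b c} h1 h2 => by
        rw [similar_iff] at *
        exact ⟨prec_trans h1.1 h2.1, prec_trans h2.2 h1.2⟩ }

/-- The collapse `L/≃`. -/
def Collapse (L : Type*) [CubicAlgebra L] : Type _ := Quotient (similarSetoid L)

/-- The class `[x]` of `x` in the collapse. -/
def toCollapse {L : Type*} [CubicAlgebra L] (x : L) : Collapse L :=
  Quotient.mk (similarSetoid L) x

end CubicAlgebra

/-! The relation `≃` is the symmetric part of a preorder `⪯`, and `⪯` agrees with `≤` on elements
with a common lower bound (`Prec.le_of_lower_bound`). This already makes each interval embed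
injectively in the collapse.

For `x`, `y` with a common lower bound, `x → y` is a `⪯`-least `w` such that `y ⪯ w` and only `⊤` is
`⪯`-above both `w` and `x`. That description mentions `⪯` alone, so `→` respects `≃` on such pairs
(`arrow_similar`).

The MR-axiom gives any finite family needed here representatives over one lower bound, so `⇒` is
well defined and the implication identities transfer from `→`. -/

namespace CubicAlgebra

open DeltaSemilattice

section Preorder

variable {L : Type*} [CubicAlgebra L]

/-- The preorder `a ⪯ b`, that is `Δ(a ∨ b, a) ≤ b`, whose symmetric part is `≃`. -/
def Prec (a b : L) : Prop := delta (a ⊔ b) a ≤ b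

theorem Prec.trans {a b c : L} (h1 : Prec a b) (h2 : Prec b c) : Prec a c :=
  prec_trans h1 h2

theorem prec_of_le {a b : L} (h : a ≤ b) : Prec a b := by
  unfold Prec
  rw [sup_of_le_right h]
  exact delta_le h

theorem similar_iff_prec {a b : L} : Similar a b ↔ Prec a b ∧ Prec b a :=
  similar_iff a b

theorem Similar.symm {a b : L} (h : Similar a b) : Similar b a :=
  (similarSetoid L).symm h

theorem similar_refl (a : L) : Similar a a := (similarSetoid L).refl a

theorem similar_delta {x b : L} (h : b ≤ x) : Similar b (delta x b) := by
  unfold Similar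
  rw [sup_comm, delta_sup b x h]

/-- On elements with a common lower bound the preorder `⪯` is the order. -/
theorem Prec.le_of_lower_bound {m x y : L} (h : Prec x y) (hx : m ≤ x) (hy : m ≤ y) :
    x ≤ y := by
  -- Both `m` and `Δ(x ∨ y, m)` lie below `y`, while their join is `x ∨ y`.
  have h1 : delta (x ⊔ y) m ≤ y := (delta_mono m x (x ⊔ y) hx le_sup_left).trans h
  have h2 := delta_sup m (x ⊔ y) (hx.trans le_sup_left)
  exact (le_sup_left.trans h2.symm.le).trans (sup_le h1 hy)

/-- If `m ⪯ u` then the class of `u` has a representative above `m`. -/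
theorem Prec.exists_similar_ge {m u : L} (h : Prec m u) : ∃ v, Similar u v ∧ m ≤ v := by
  -- Reflecting `Δ(m ∨ u, m) ≤ u` in `m ∨ u`, a monotone involution, gives `m ≤ Δ(m ∨ u, u)`.
  refine ⟨delta (m ⊔ u) u, similar_delta le_sup_right, ?_⟩
  have h1 := delta_mono _ _ (m ⊔ u) h le_sup_right
  rwa [delta_invol m _ le_sup_left] at h1

theorem top_prec_iff {u : L} : Prec ⊤ u ↔ u = ⊤ := by
  unfold Prec
  rw [sup_of_le_left le_top, delta_self, top_le_iff]

theorem arrow_le_of_sup_eq_top {x y w : L} (hy : y ≤ w) (hw : x ⊔ w = ⊤) :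
    arrow x y ≤ w := by
  refine (arrow_mono hy x).trans ?_
  rw [← arrow_eq_top_iff, arrow_arrow, hw]

/-- `w` is an upper bound of `y` whose join with `x` in the collapse is the greatest element. -/
def IsCocover (x y w : L) : Prop :=
  Prec y w ∧ ∀ u, Prec w u → Prec x u → u = ⊤

/-- A representative of `u` above `m` is comparable by `≤`, hence lies above both `x` and `x → y`,
whose join is `⊤`; and `⊤` is alone in its class. -/
theorem isCocover_arrow {m x y : L} (hx : m ≤ x) (hy : m ≤ y) : IsCocover x y (arrow x y) := by
  refine ⟨prec_of_le (le_arrow x y), fun u h1 h2 => ?_⟩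
  obtain ⟨v, huv, hv⟩ := ((prec_of_le hx).trans h2).exists_similar_ge
  have huv' := similar_iff_prec.1 huv
  have h3 := (h1.trans huv'.1).le_of_lower_bound (hy.trans (le_arrow x y)) hv
  have h4 := (h2.trans huv'.1).le_of_lower_bound hx hv
  have h5 : v = ⊤ := top_unique ((arrow_sup x y).symm.le.trans (sup_le h3 h4))
  rw [h5] at huv'
  exact top_prec_iff.1 huv'.2

/-- This is the minimality of `x → y`. A representative `v ≥ m` of `w` satisfies `y ≤ v` and `x ∨ v
= ⊤`, so `x → y ≤ x → v ≤ v`. -/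
theorem IsCocover.arrow_prec {m x y w : L} (h : IsCocover x y w) (hy : m ≤ y) :
    Prec (arrow x y) w := by
  obtain ⟨v, hwv, hv⟩ := ((prec_of_le hy).trans h.1).exists_similar_ge
  have hwv' := similar_iff_prec.1 hwv
  have h1 := (h.1.trans hwv'.1).le_of_lower_bound hy hv
  have h2 : x ⊔ v = ⊤ :=
    h.2 _ (hwv'.1.trans (prec_of_le le_sup_right)) (prec_of_le le_sup_left)
  exact (prec_of_le (arrow_le_of_sup_eq_top h1 h2)).trans hwv'.2

theorem IsCocover.congr {x x' y y' w : L} (h : IsCocover x y w) (hx : Similar x x')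
    (hy : Similar y y') : IsCocover x' y' w :=
  ⟨(similar_iff_prec.1 hy).2.trans h.1,
    fun u h1 h2 => h.2 u h1 ((similar_iff_prec.1 hx).1.trans h2)⟩

/-- On pairs with a common lower bound, `→` respects `≃`. -/
theorem arrow_similar {m m' x x' y y' : L} (hx : m ≤ x) (hy : m ≤ y) (hx' : m' ≤ x')
    (hy' : m' ≤ y') (hxx : Similar x x') (hyy : Similar y y') :
    Similar (arrow x y) (arrow x' y') :=
  similar_iff_prec.2
    ⟨((isCocover_arrow hx' hy').congr hxx.symm hyy.symm).arrow_prec hy,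
      ((isCocover_arrow hx hy).congr hxx hyy).arrow_prec hy'⟩

theorem toCollapse_eq_iff {x y : L} : toCollapse x = toCollapse y ↔ Similar x y :=
  Quotient.eq (r := similarSetoid L)

theorem toCollapse_surjective : Function.Surjective (toCollapse (L := L)) :=
  Quotient.mk_surjective

end Preorder

section MR

variable {L : Type*} [MRAlgebra L]

/-- In an MR-algebra `Δ(a ∨ b, a)` and `b` have a common lower bound. -/
theorem exists_le_delta_sup (a b : L) : ∃ m, m ≤ delta (a ⊔ b) a ∧ m ≤ b := by
  by_cases hba : b ≤ a
  · exact ⟨b, by rwa [sup_of_le_left hba, delta_self], le_rfl⟩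
  by_cases hab : a ≤ b
  · exact ⟨delta (a ⊔ b) a, le_rfl, prec_of_le hab⟩
  have ha : a < a ⊔ b := left_lt_sup.2 hba
  have hb : b < a ⊔ b := right_lt_sup.2 hab
  have hd : delta (a ⊔ b) a < a ⊔ b := by
    refine lt_of_le_of_ne (delta_le ha.le) fun h => ha.ne ?_
    have h1 := delta_invol a _ ha.le
    rw [h, delta_self] at h1
    exact h1.symm
  -- Reflecting `Δ(a ∨ b, a)` returns `a`, whose join with `b` is not strictly below `a ∨ b`; so the
  -- meet of `Δ(a ∨ b, a)` and `b` exists.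
  have h := MRAlgebra.mr_axiom _ _ _ hd hb
  rw [delta_invol a _ ha.le] at h
  obtain ⟨m, hm⟩ := not_not.1 fun hn => lt_irrefl _ (h.2 hn)
  exact ⟨m, hm.1 (by simp), hm.1 (by simp)⟩

/-- Replacing `a` by a similar element gives a common lower bound with any given `b`. -/
theorem exists_similar_lower_bound (a b : L) : ∃ a' m, Similar a a' ∧ m ≤ a' ∧ m ≤ b := by
  obtain ⟨m, h1, h2⟩ := exists_le_delta_sup a b
  exact ⟨_, m, similar_delta le_sup_left, h1, h2⟩

/-- `⇒` computed by any representatives with a common lower bound. -/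
theorem collapseArrow_similar {m a b x y : L} (hx : m ≤ x) (hy : m ≤ y) (hax : Similar a x)
    (hby : Similar b y) : Similar (collapseArrow a b) (arrow x y) := by
  obtain ⟨m', h1, h2⟩ := exists_le_delta_sup a b
  exact arrow_similar h1 h2 hx hy
    ((similarSetoid L).trans (similar_delta le_sup_left).symm hax) hby

theorem collapseArrow_congr {a a' b b' : L} (ha : Similar a a') (hb : Similar b b') :
    Similar (collapseArrow a b) (collapseArrow a' b') := by
  obtain ⟨m, h1, h2⟩ := exists_le_delta_sup a' b'
  exact collapseArrow_similar h1 h2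
    ((similarSetoid L).trans ha (similar_delta le_sup_left)) hb

/-- The operation `[a] → [b] = [a ⇒ b]` on the collapse. -/
def Collapse.imp : Collapse L → Collapse L → Collapse L :=
  Quotient.map₂ collapseArrow fun _ _ ha _ _ hb => collapseArrow_congr ha hb

theorem Collapse.imp_toCollapse (a b : L) :
    Collapse.imp (toCollapse a) (toCollapse b) = toCollapse (collapseArrow a b) := rfl

theorem Collapse.imp_toCollapse_of_le {m x y : L} (hx : m ≤ x) (hy : m ≤ y) :
    Collapse.imp (toCollapse x) (toCollapse y) = toCollapse (arrow x y) :=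
  toCollapse_eq_iff.2 (collapseArrow_similar hx hy (similar_refl x) (similar_refl y))

/-- Two elements of the collapse have representatives with a common lower bound, one of which
may be prescribed. -/
theorem Collapse.exists_rep (p : Collapse L) (b : L) :
    ∃ x m, toCollapse x = p ∧ m ≤ x ∧ m ≤ b := by
  obtain ⟨a, rfl⟩ := toCollapse_surjective p
  obtain ⟨a', m, h, h1, h2⟩ := exists_similar_lower_bound a b
  exact ⟨a', m, toCollapse_eq_iff.2 h.symm, h1, h2⟩

/-- The collapse of an MR-algebra is an implication algebra. -/
instance collapseImplicationAlgebra : ImplicationAlgebra (Collapse L) where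
  imp := Collapse.imp
  imp_contraction p q := by
    obtain ⟨y, rfl⟩ := toCollapse_surjective q
    obtain ⟨x, m, rfl, hx, hy⟩ := Collapse.exists_rep p y
    rw [Collapse.imp_toCollapse_of_le hx hy,
      Collapse.imp_toCollapse_of_le (hy.trans (le_arrow x y)) hx]
    exact congrArg toCollapse (ImplicationAlgebra.imp_contraction x y)
  imp_quasi_comm p q := by
    obtain ⟨y, rfl⟩ := toCollapse_surjective q
    obtain ⟨x, m, rfl, hx, hy⟩ := Collapse.exists_rep p y
    rw [Collapse.imp_toCollapse_of_le hx hy, Collapse.imp_toCollapse_of_le hy hx,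
      Collapse.imp_toCollapse_of_le (hy.trans (le_arrow x y)) hy,
      Collapse.imp_toCollapse_of_le (hx.trans (le_arrow y x)) hx]
    exact congrArg toCollapse (ImplicationAlgebra.imp_quasi_comm x y)
  imp_exchange p q r := by
    obtain ⟨z, rfl⟩ := toCollapse_surjective r
    obtain ⟨y, n, rfl, hny, hnz⟩ := Collapse.exists_rep q z
    -- Prescribing the lower bound `n` of `y` and `z` puts all three representatives above `m`.
    obtain ⟨x, m, rfl, hx, hmn⟩ := Collapse.exists_rep p n
    have hy := hmn.trans hny
    have hz := hmn.trans hnz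
    rw [Collapse.imp_toCollapse_of_le hy hz, Collapse.imp_toCollapse_of_le hx hz,
      Collapse.imp_toCollapse_of_le hx (hz.trans (le_arrow y z)),
      Collapse.imp_toCollapse_of_le hy (hz.trans (le_arrow x z)), arrow_exchange]

/-- Each interval `[a, 1]` embeds into the collapse. -/
theorem isImplicationEmbedding_toCollapse (a : L) :
    IsImplicationEmbedding (fun x : Set.Icc a (⊤ : L) => toCollapse (x : L)) := by
  refine ⟨fun x y h => ?_, fun x y => (Collapse.imp_toCollapse_of_le x.2.1 y.2.1).symm⟩
  have h1 := similar_iff_prec.1 (toCollapse_eq_iff.1 h)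
  exact Subtype.ext (le_antisymm (h1.1.le_of_lower_bound x.2.1 y.2.1)
    (h1.2.le_of_lower_bound y.2.1 x.2.1))

end MR

end CubicAlgebra

open CubicAlgebra in
theorem mainTheorem6 (L : Type*) [MRAlgebra L] :
    ∃ C : ImplicationAlgebra (Collapse L),
      (∀ x y : L, C.imp (toCollapse x) (toCollapse y) = toCollapse (collapseArrow x y)) ∧
      ∀ a : L, IsImplicationEmbedding (fun x : Set.Icc a (⊤ : L) => toCollapse (x : L)) :=
  ⟨collapseImplicationAlgebra, Collapse.imp_toCollapse, isImplicationEmbedding_toCollapse⟩
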